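/- For a permutation $\sigma=\sigma_1\cdots\sigma_n$ of $[n]$, an alternating inversion is a pair $i<j$ such that either $i$ is odd and $\sigma_i>\sigma_j$, or $i$ is even and $\sigma_i<\sigma_j$; let $\hat\imath(\sigma)$ be the number of alternating inversions of $\sigma$. Let $\mathrm{Alt}_n$ be the set of down-up permutations of $[n]$ (those with $\sigma_1>\sigma_2<\sigma_3>\cdots$), and put $$\hat E_n(q)=q^{-\lfloor n^2/4\rfloor}\sum_{\sigma\in \mathrm{Alt}_n}q^{\hat\imath(\sigma)},\qquad [k]_q=1+q+\cdots+q^{k-1}.$$ A Dyck path of length $2m$ is a lattice path from $(0,0)$ to $(2m,0)$ with steps $(1,1)$ (up-steps) and $(1,-1)$ (down-steps) that never goes below the $x$-axis. The level $\ell_{\mathcal D}(i)$ of the $i$-th step of a Dyck path $\mathcal D$ is the $y$-coordinate of the highest point of that step. **Theorem 9.4.** For every integer $m\ge 0$, as identities of Laurent polynomials in $q$ with integer coefficients, $$\sum_{\mathcal D}\ \prod_{i=1}^{2m}[\ell_{\mathcal D}(i)]_q=\hat E_{2m}(q)$$ and $$\sum_{\mathcal D}\ \Bigl(\prod_{i\text{-th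 step up}}[\ell_{\mathcal D}(i)]_q\Bigr)\Bigl(\prod_{i\text{-th step down}}[\ell_{\mathcal D}(i)+1]_q\Bigr)=\hat E_{2m+1}(q),$$ where both sums are over all Dyck paths $\mathcal D$ of length $2m$. (In particular, $\hat E_n(q)$ is a polynomial in $q$ for every $n\ge 0$.) -/

import Mathlib

open scoped LaurentPolynomial

namespace AltInv

/-- The `q`-integer `[k]_q = 1 + q + ⋯ + q^(k-1)`, as a polynomial in `q = X`. -/
noncomputable def qInt (k : ℕ) : Polynomial ℤ :=
  ∑ j ∈ Finset.range k, Polynomial.X ^ j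

/-- The permutation `σ` is down-up: `σ₁ > σ₂ < σ₃ > ⋯`. Positions in `Fin n` start at `0`, so the
(1-based) odd positions are those with even underlying value. -/
def IsDownUp {n : ℕ} (σ : Equiv.Perm (Fin n)) : Prop :=
  ∀ i j : Fin n, (j : ℕ) = (i : ℕ) + 1 →
    (Even (i : ℕ) → σ j < σ i) ∧ (Odd (i : ℕ) → σ i < σ j)

instance {n : ℕ} : DecidablePred (IsDownUp (n := n)) := fun σ => by
  unfold IsDownUp; infer_instance

/-- The pair of positions `(i, j)` is an alternating inversion of `σ`: `i < j` and either `i` is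
odd (1-based; even 0-based) and `σ i > σ j`, or `i` is even (1-based; odd 0-based) and
`σ i < σ j`. -/
def IsAltInversion {n : ℕ} (σ : Equiv.Perm (Fin n)) (i j : Fin n) : Prop :=
  i < j ∧ ((Even (i : ℕ) ∧ σ j < σ i) ∨ (Odd (i : ℕ) ∧ σ i < σ j))

instance {n : ℕ} (σ : Equiv.Perm (Fin n)) (i j : Fin n) : Decidable (IsAltInversion σ i j) := by
  unfold IsAltInversion; infer_instance

/-- The number of alternating inversions of `σ`. -/
def altInv {n : ℕ} (σ : Equiv.Perm (Fin n)) : ℕ :=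
  (Finset.univ.filter fun p : Fin n × Fin n => IsAltInversion σ p.1 p.2).card

/-- `Ê_n(q) = q^(-⌊n²/4⌋) ∑_σ q^(î(σ))`, over the down-up permutations `σ` of size `n`, as a
Laurent polynomial in `q = T 1`. -/
noncomputable def eulerHat (n : ℕ) : ℤ[T;T⁻¹] :=
  LaurentPolynomial.T (-((n ^ 2 / 4 : ℕ) : ℤ)) *
    ∑ σ : Equiv.Perm (Fin n) with IsDownUp σ, LaurentPolynomial.T (altInv σ : ℤ)

/-- The height (`y`-coordinate) of the Dyck path `p` after its first `i` steps. The subtraction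
never truncates, since a Dyck path stays weakly above the axis. -/
def height (p : DyckWord) (i : ℕ) : ℕ :=
  (p.toList.take i).count DyckStep.U - (p.toList.take i).count DyckStep.D

/-- The level of the step of `p` from abscissa `i` to abscissa `i + 1`: the `y`-coordinate of the
highest point of this segment. -/
def level (p : DyckWord) (i : ℕ) : ℕ :=
  max (height p i) (height p (i + 1))

/-- The even weight of a path: the product of `[level]_q` over all its steps. -/
noncomputable def evenWeight (p : DyckWord) : Polynomial ℤ :=
  ∏ i : Fin p.toList.length, qInt (level p i)

/-- The odd weight of a path: the product over its steps of `[level]_q` for an up-step and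
`[level + 1]_q` for a down-step. -/
noncomputable def oddWeight (p : DyckWord) : Polynomial ℤ :=
  ∏ i : Fin p.toList.length,
    if p.toList.get i = DyckStep.U then qInt (level p i) else qInt (level p i + 1)

end AltInv

namespace AltInv

open Polynomial Finset

/-! Both sides satisfy one `q`-Seidel recursion. Deleting the first value of a down-up permutation
and complementing the rest gives a down-up permutation; refining by the first value yields the
triangle `seidel` (`downUpSum_eq_seidel`). On the path side, at `q = 1`, summing `tan^h x * sec y *
tan^h y` over `h` gives `cos x / cos (x + y)`, and one more factor `tan x` gives `sin x / cos (x +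
y)`. Differentiating in `x` and `y` relates these two functions; the `q`-analogues of those
relations are exactly the Seidel recursion along alternate rows (`seidel_eq_pairing`). At the end of
a row one factor of the pairing is trivial, leaving a single weighted Dyck path sum. -/

theorem qInt_zero : qInt 0 = 0 := by simp [qInt]

theorem qInt_succ (k : ℕ) : qInt (k + 1) = 1 + X * qInt k := by
  simp [qInt, Finset.sum_range_succ', Finset.mul_sum, pow_succ', add_comm]

/-! ### Weighted Dyck paths as step-by-step recursions. -/

section PathSum

variable {R : Type*} [CommRing R]

/-- Weighted number of nonnegative lattice paths from height `h` to height `0` in `n` steps, where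
an up-step from `k` to `k + 1` has weight `u k`, and a down-step from `k + 1` to `k` has weight
`d k`. -/
def pathSum (u d : ℕ → R) : ℕ → ℕ → R
  | 0, 0 => 1
  | 0, _ + 1 => 0
  | n + 1, 0 => u 0 * pathSum u d n 1
  | n + 1, h + 1 => u (h + 1) * pathSum u d n (h + 2) + d h * pathSum u d n h

theorem pathSum_eq_zero_of_lt (u d : ℕ → R) {n h : ℕ} (hn : n < h) : pathSum u d n h = 0 := by
  induction n generalizing h with
  | zero => obtain ⟨h, rfl⟩ : ∃ k, h = k + 1 := ⟨h - 1, by omega⟩; rfl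
  | succ n ih =>
    obtain ⟨h, rfl⟩ : ∃ k, h = k + 1 := ⟨h - 1, by omega⟩
    rw [pathSum, ih (by omega), ih (by omega)]
    simp

/-- Weight of a list of steps starting at height `h`. -/
def listWeight (u d : ℕ → R) : ℕ → List DyckStep → R
  | _, [] => 1
  | h, DyckStep.U :: l => u h * listWeight u d (h + 1) l
  | h, DyckStep.D :: l => d (h - 1) * listWeight u d (h - 1) l

/-- The lists of `n` steps which lead from height `h` to `0` and stay nonnegative. -/
def pathLists : ℕ → ℕ → Finset (List DyckStep)
  | 0, 0 => {[]}
  | 0, _ + 1 => ∅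
  | n + 1, 0 => (pathLists n 1).map ⟨List.cons DyckStep.U, List.cons_injective⟩
  | n + 1, h + 1 => (pathLists n (h + 2)).map ⟨List.cons DyckStep.U, List.cons_injective⟩ ∪
      (pathLists n h).map ⟨List.cons DyckStep.D, List.cons_injective⟩

theorem sum_pathLists (u d : ℕ → R) (n h : ℕ) :
    ∑ l ∈ pathLists n h, listWeight u d h l = pathSum u d n h := by
  induction n generalizing h with
  | zero => cases h <;> simp [pathLists, pathSum, listWeight]
  | succ n ih =>
    cases h with
    | zero => simp [pathLists, pathSum, listWeight, ← ih, Finset.mul_sum]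
    | succ h =>
      rw [pathLists, Finset.sum_union]
      · simp [pathSum, listWeight, ← ih, Finset.mul_sum]
      · rw [Finset.disjoint_left]
        intro l hl hl'
        simp only [Finset.mem_map, Function.Embedding.coeFn_mk] at hl hl'
        obtain ⟨a, -, rfl⟩ := hl
        obtain ⟨b, -, hb⟩ := hl'
        simp at hb

theorem nonneg_cons_U_iff (h : ℕ) (l : List DyckStep) :
    (∀ i, ((DyckStep.U :: l).take i).count DyckStep.D ≤
        h + ((DyckStep.U :: l).take i).count DyckStep.U) ↔
      ∀ i, (l.take i).count DyckStep.D ≤ h + 1 + (l.take i).count DyckStep.U := by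
  constructor
  · intro H i
    have := H (i + 1)
    simp at this
    omega
  · rintro H (_ | i)
    · simp
    · have := H i
      simp
      omega

theorem nonneg_cons_D_iff (h : ℕ) (l : List DyckStep) :
    (∀ i, ((DyckStep.D :: l).take i).count DyckStep.D ≤
        h + ((DyckStep.D :: l).take i).count DyckStep.U) ↔
      0 < h ∧ ∀ i, (l.take i).count DyckStep.D ≤ h - 1 + (l.take i).count DyckStep.U := by
  constructor
  · intro H
    have h1 := H 1
    simp at h1
    refine ⟨h1, fun i => ?_⟩
    have := H (i + 1)
    simp at this
    omega
  · rintro ⟨h0, H⟩ (_ | i)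
    · simp
    · have := H i
      simp
      omega

theorem mem_pathLists {n h : ℕ} {l : List DyckStep} :
    l ∈ pathLists n h ↔ l.length = n ∧
      (∀ i, (l.take i).count DyckStep.D ≤ h + (l.take i).count DyckStep.U) ∧
      l.count DyckStep.D = h + l.count DyckStep.U := by
  induction n generalizing h l with
  | zero =>
    cases h with
    | zero =>
      simp only [pathLists, Finset.mem_singleton, List.length_eq_zero_iff]
      constructor
      · rintro rfl; simp
      · exact fun H => H.1
    | succ h =>
      simp only [pathLists, Finset.notMem_empty, List.length_eq_zero_iff, false_iff]
      rintro ⟨rfl, -, H⟩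
      simp at H
  | succ n ih =>
    rcases l with _ | ⟨s, l⟩
    · cases h <;> simp [pathLists]
    cases s with
    | U =>
      rw [nonneg_cons_U_iff]
      have := @ih (h + 1) l
      cases h <;> simp [pathLists] at this ⊢ <;> rw [this] <;> grind
    | D =>
      rw [nonneg_cons_D_iff]
      have := @ih (h - 1) l
      cases h <;> simp [pathLists] at this ⊢
      rw [this]
      grind

theorem prod_eq_listWeight (wU wD : ℕ → R) (l : List DyckStep) (h : ℕ)
    (H : ∀ i, (l.take i).count DyckStep.D ≤ h + (l.take i).count DyckStep.U) :
    (∏ i : Fin l.length,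
      let k := max (h + (l.take i).count DyckStep.U - (l.take i).count DyckStep.D)
        (h + (l.take (i + 1)).count DyckStep.U - (l.take (i + 1)).count DyckStep.D)
      if l.get i = DyckStep.U then wU k else wD k) =
    listWeight (fun k => wU (k + 1)) (fun k => wD (k + 1)) h l := by
  induction l generalizing h with
  | nil => simp [listWeight]
  | cons s l ih =>
    cases s with
    | U =>
      rw [nonneg_cons_U_iff] at H
      have := ih (h + 1) H
      simp only [List.length_cons, Fin.prod_univ_succ, listWeight]
      rw [← this]
      congr 1
      · simp
      · refine Finset.prod_congr rfl fun i _ => ?_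
        simp [add_assoc, add_comm 1]
    | D =>
      rw [nonneg_cons_D_iff] at H
      obtain ⟨h0, H⟩ := H
      have := ih (h - 1) H
      simp only [List.length_cons, Fin.prod_univ_succ, listWeight]
      rw [← this]
      congr 1
      · simp [Nat.sub_add_cancel h0]
      · refine Finset.prod_congr rfl fun i _ => ?_
        have e (a b : ℕ) : h + a - (b + 1) = h - 1 + a - b := by omega
        simp [e]

/-- The product of weights over the steps of a Dyck path, depending on direction and level. -/
def wordWeight (wU wD : ℕ → R) (p : DyckWord) : R :=
  ∏ i : Fin p.toList.length,
    if p.toList.get i = DyckStep.U then wU (level p i) else wD (level p i)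

theorem sum_wordWeight (wU wD : ℕ → R) (m : ℕ) :
    ∑ p : { p : DyckWord // p.semilength = m }, wordWeight wU wD p.1 =
      pathSum (fun k => wU (k + 1)) (fun k => wD (k + 1)) (2 * m) 0 := by
  rw [← sum_pathLists]
  refine Finset.sum_bij (fun p _ => p.1.toList) ?_ ?_ ?_ ?_
  · rintro ⟨p, rfl⟩ -
    rw [mem_pathLists]
    refine ⟨p.two_mul_semilength_eq_length.symm, fun i => ?_, ?_⟩
    · simpa using p.count_D_le_count_U i
    · simpa using p.count_U_eq_count_D.symm
  · rintro ⟨p, hp⟩ - ⟨p', hp'⟩ - h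
    exact Subtype.ext (DyckWord.ext h)
  · intro l hl
    rw [mem_pathLists] at hl
    obtain ⟨h1, h2, h3⟩ := hl
    refine ⟨⟨⟨l, by simpa using h3.symm, by simpa using h2⟩, ?_⟩, Finset.mem_univ _, rfl⟩
    have := DyckWord.two_mul_semilength_eq_length
      (p := ⟨l, by simpa using h3.symm, by simpa using h2⟩)
    simp only [h1] at this
    omega
  · rintro ⟨p, hp⟩ -
    rw [← prod_eq_listWeight _ _ _ _ (by simpa using p.count_D_le_count_U)]
    simp [wordWeight, level, height]

theorem wordWeight_smul_up (q : R) (wU wD : ℕ → R) (p : DyckWord) :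
    wordWeight (fun k => q * wU k) wD p = q ^ p.semilength * wordWeight wU wD p := by
  have (l : List DyckStep) (h : ℕ) (u d : ℕ → R) :
      listWeight (fun k => q * u k) d h l = q ^ l.count DyckStep.U * listWeight u d h l := by
    induction l generalizing h with
    | nil => simp [listWeight]
    | cons s l ih =>
      cases s <;> simp [listWeight, ih, pow_succ] <;> ring
  have e (wU wD : ℕ → R) : wordWeight wU wD p =
      listWeight (fun k => wU (k + 1)) (fun k => wD (k + 1)) 0 p.toList := by
    rw [← prod_eq_listWeight _ _ _ _ (by simpa using p.count_D_le_count_U)]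
    simp [wordWeight, level, height]
  rw [e, e, this]
  rfl

end PathSum

theorem sum_evenWeight (m : ℕ) :
    ∑ p : { p : DyckWord // p.semilength = m }, evenWeight p.1 =
      pathSum (fun k => qInt (k + 1)) (fun k => qInt (k + 1)) (2 * m) 0 := by
  rw [← sum_wordWeight qInt qInt]
  simp [wordWeight, evenWeight]

/-- One factor `q` on each of the `m` up-steps turns the odd weights into those of `tanSum`, shifted
by one. -/
theorem sum_oddWeight (m : ℕ) :
    X ^ m * ∑ p : { p : DyckWord // p.semilength = m }, oddWeight p.1 =
      pathSum (fun k => X * qInt (k + 1)) (fun k => qInt (k + 2)) (2 * m) 0 := by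
  rw [← sum_wordWeight (fun k => X * qInt k) (fun k => qInt (k + 1)), Finset.mul_sum]
  refine Finset.sum_congr rfl fun p _ => ?_
  rw [wordWeight_smul_up, p.2]
  rfl

/-! ### Pairings of tangent and secant path sums. -/

/-- Path sums whose generating functions are `q`-analogues of `sec x * (tan x) ^ h`. -/
noncomputable def secSum : ℕ → ℕ → ℤ[X] :=
  pathSum (fun k => qInt (k + 1)) (fun k => qInt (k + 1))

/-- Path sums whose generating functions are `q`-analogues of `(tan x) ^ h`. -/
noncomputable def tanSum : ℕ → ℕ → ℤ[X] :=
  pathSum (fun k => X * qInt k) (fun k => qInt (k + 1))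

theorem secSum_succ_zero (n : ℕ) : secSum (n + 1) 0 = qInt 1 * secSum n 1 := rfl

theorem secSum_succ_succ (n h : ℕ) :
    secSum (n + 1) (h + 1) = qInt (h + 2) * secSum n (h + 2) + qInt (h + 1) * secSum n h := rfl

theorem tanSum_succ_zero (n : ℕ) : tanSum (n + 1) 0 = 0 := by
  simp [tanSum, pathSum, qInt_zero]

theorem tanSum_succ_succ (n h : ℕ) :
    tanSum (n + 1) (h + 1) =
      X * qInt (h + 1) * tanSum n (h + 2) + qInt (h + 1) * tanSum n h := rfl

theorem tanSum_eq_zero_of_lt {n h : ℕ} (hn : n < h) : tanSum n h = 0 :=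
  pathSum_eq_zero_of_lt _ _ hn

/-- An up-step from height `0` weighs `q[0] = 0`, so a contributing path reaches `0` only at its
last step, of weight `[1] = 1`. Delete that step and lower the path by one. -/
theorem tanSum_succ_succ_eq_pathSum (n h : ℕ) :
    tanSum (n + 1) (h + 1) = pathSum (fun k => X * qInt (k + 1)) (fun k => qInt (k + 2)) n h := by
  induction n generalizing h with
  | zero =>
    rw [tanSum_succ_succ]
    cases h <;> simp [tanSum, pathSum, qInt]
  | succ n ih =>
    rw [tanSum_succ_succ, ih]
    cases h with
    | zero => simp [pathSum, tanSum_succ_zero]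
    | succ h => rw [ih]; simp [pathSum]

/-- A `q`-analogue of the coefficients of `cos x / cos (x + y)`. -/
noncomputable def evenPairing (N a b : ℕ) : ℤ[X] :=
  ∑ h ∈ range (N + 1), tanSum a h * secSum b h

/-- A `q`-analogue of the coefficients of `sin x / cos (x + y)`. -/
noncomputable def oddPairing (N a b : ℕ) : ℤ[X] :=
  ∑ h ∈ range (N + 1), tanSum a (h + 1) * secSum b h

/-- Expanding one step of each path, the sum over `h` telescopes except for the mismatch `[h+1] -
q[h] = 1`, which produces `oddPairing`. The right side is the boundary term at `N`; it vanishes for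
`a < N`. -/
theorem evenPairing_succ_sub (N a b : ℕ) :
    evenPairing N a (b + 1) - evenPairing N (a + 1) b - oddPairing N a b =
      qInt (N + 1) * (tanSum a N * secSum b (N + 1) - tanSum a (N + 1) * secSum b N) := by
  induction N with
  | zero =>
    simp [evenPairing, oddPairing, secSum_succ_zero, tanSum_succ_zero, qInt_succ, qInt_zero]
  | succ N ih =>
    simp only [evenPairing, oddPairing] at ih ⊢
    rw [sum_range_succ _ (N + 1), sum_range_succ _ (N + 1), sum_range_succ _ (N + 1),
      secSum_succ_succ, tanSum_succ_succ]
    rw [qInt_succ (N + 1)]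
    linear_combination ih

theorem oddPairing_succ_sub (N a b : ℕ) :
    oddPairing N (a + 1) b - X * oddPairing N a (b + 1) - evenPairing N a b =
      X * qInt (N + 1) * (tanSum a (N + 2) * secSum b N - tanSum a (N + 1) * secSum b (N + 1)) := by
  induction N with
  | zero =>
    simp [evenPairing, oddPairing, secSum_succ_zero, tanSum_succ_succ, qInt_succ, qInt_zero]
    ring
  | succ N ih =>
    simp only [evenPairing, oddPairing] at ih ⊢
    rw [sum_range_succ _ (N + 1), sum_range_succ _ (N + 1), sum_range_succ _ (N + 1),
      secSum_succ_succ, tanSum_succ_succ]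
    rw [qInt_succ (N + 1)]
    linear_combination ih

theorem evenPairing_succ_right {N a : ℕ} (b : ℕ) (h : a < N) :
    evenPairing N a (b + 1) = evenPairing N (a + 1) b + oddPairing N a b := by
  have := evenPairing_succ_sub N a b
  rw [tanSum_eq_zero_of_lt h, tanSum_eq_zero_of_lt (by omega : a < N + 1)] at this
  linear_combination this

theorem oddPairing_succ_left {N a : ℕ} (b : ℕ) (h : a < N) :
    oddPairing N (a + 1) b = X * oddPairing N a (b + 1) + evenPairing N a b := by
  have := oddPairing_succ_sub N a b
  rw [tanSum_eq_zero_of_lt (by omega : a < N + 2),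
    tanSum_eq_zero_of_lt (by omega : a < N + 1)] at this
  linear_combination this

theorem secSum_zero_succ (h : ℕ) : secSum 0 (h + 1) = 0 := rfl

theorem tanSum_zero_succ (h : ℕ) : tanSum 0 (h + 1) = 0 := rfl

theorem evenPairing_succ_zero (N a : ℕ) : evenPairing N (a + 1) 0 = 0 := by
  simp [evenPairing, Finset.sum_range_succ', secSum_zero_succ, tanSum_succ_zero]

theorem evenPairing_zero_left (N b : ℕ) : evenPairing N 0 b = secSum b 0 := by
  simp [evenPairing, Finset.sum_range_succ', tanSum_zero_succ]
  simp [tanSum, pathSum]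

theorem oddPairing_zero_left (N b : ℕ) : oddPairing N 0 b = 0 := by
  simp [oddPairing, tanSum_zero_succ]

theorem oddPairing_zero_right (N a : ℕ) : oddPairing N a 0 = tanSum a 1 := by
  simp [oddPairing, Finset.sum_range_succ', secSum_zero_succ]
  simp [secSum, pathSum]

/-! ### The Seidel triangle computed by the pairings. -/

/-- A `q`-analogue of the Seidel triangle of Entringer numbers. -/
noncomputable def seidel : ℕ → ℕ → ℤ[X]
  | 0, _ => 1
  | _ + 1, 0 => 0
  | k + 1, d + 1 => seidel (k + 1) d + X ^ (k - d) * seidel k (k - d)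
termination_by k d => (k, d)

/-- Rows are read in alternate directions: as `d` grows, steps pass from the tangent to the secant
factor in even rows and back in odd rows. The factor `X ^ d` avoids negative powers of `q`. -/
theorem seidel_eq_pairing {N : ℕ} (m : ℕ) :
    (2 * m ≤ N → ∀ d ≤ 2 * m, seidel (2 * m) d = X ^ m ^ 2 * evenPairing N (2 * m - d) d) ∧
    (2 * m + 1 ≤ N → ∀ d ≤ 2 * m + 1, X ^ d * seidel (2 * m + 1) d =
      X ^ (m + 1) ^ 2 * oddPairing N d (2 * m + 1 - d)) := by
  have odd_of_even (m : ℕ)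
      (H : 2 * m ≤ N → ∀ d ≤ 2 * m,
        seidel (2 * m) d = X ^ m ^ 2 * evenPairing N (2 * m - d) d) :
      2 * m + 1 ≤ N → ∀ d ≤ 2 * m + 1, X ^ d * seidel (2 * m + 1) d =
        X ^ (m + 1) ^ 2 * oddPairing N d (2 * m + 1 - d) := by
    intro hN d hd
    induction d with
    | zero => simp [seidel, oddPairing_zero_left]
    | succ d ih =>
      have e : X ^ (d + 1) * (X ^ (2 * m - d) * (X ^ m ^ 2 : ℤ[X])) = X ^ (m + 1) ^ 2 := by
        rw [← pow_add, ← pow_add]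
        congr 1
        have : d ≤ 2 * m := by omega
        zify [this]
        ring
      have ih := ih (by omega)
      rw [seidel, H (by omega) _ (by omega), oddPairing_succ_left _ (by omega),
        show 2 * m - (2 * m - d) = d by omega, show 2 * m + 1 - (d + 1) = 2 * m - d by omega]
      rw [show 2 * m + 1 - d = 2 * m - d + 1 by omega] at ih
      linear_combination X * ih + e * evenPairing N d (2 * m - d)
  induction m with
  | zero =>
    have H : 2 * 0 ≤ N → ∀ d ≤ 2 * 0,
        seidel (2 * 0) d = X ^ 0 ^ 2 * evenPairing N (2 * 0 - d) d := by
      intro _ d hd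
      obtain rfl : d = 0 := by omega
      simp [seidel, evenPairing_zero_left, secSum, pathSum]
    exact ⟨H, odd_of_even 0 H⟩
  | succ m IH =>
    have H : 2 * (m + 1) ≤ N → ∀ d ≤ 2 * (m + 1),
        seidel (2 * (m + 1)) d =
          X ^ (m + 1) ^ 2 * evenPairing N (2 * (m + 1) - d) d := by
      intro hN d hd
      rw [show 2 * (m + 1) = 2 * m + 1 + 1 by ring] at hN hd ⊢
      induction d with
      | zero => simp [seidel, evenPairing_succ_zero]
      | succ d ih =>
        have ih := ih (by omega)
        have e := IH.2 (by omega) (2 * m + 1 - d) (by omega)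
        rw [show 2 * m + 1 - (2 * m + 1 - d) = d by omega] at e
        rw [seidel, show 2 * m + 1 + 1 - (d + 1) = 2 * m + 1 - d by omega,
          evenPairing_succ_right _ (by omega), ih, e,
          show 2 * m + 1 + 1 - d = 2 * m + 1 - d + 1 by omega]
        ring
    exact ⟨H, odd_of_even _ H⟩

theorem seidel_even (m : ℕ) : seidel (2 * m) (2 * m) = X ^ m ^ 2 * secSum (2 * m) 0 := by
  simpa [evenPairing_zero_left] using (seidel_eq_pairing m).1 le_rfl (2 * m) le_rfl

theorem seidel_odd (m : ℕ) :
    X ^ (2 * m + 1) * seidel (2 * m + 1) (2 * m + 1) =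
      X ^ (m + 1) ^ 2 * tanSum (2 * m + 1) 1 := by
  simpa [oddPairing_zero_right] using (seidel_eq_pairing m).2 le_rfl (2 * m + 1) le_rfl

/-! ### Down-up permutations and the Seidel triangle. -/

/-- The permutation with first value `p`, whose other values are in the reverse order of those
of `τ`. -/
def consRev {n : ℕ} (p : Fin (n + 1)) (τ : Equiv.Perm (Fin n)) : Equiv.Perm (Fin (n + 1)) :=
  ((finSuccEquiv n).trans (Equiv.optionCongr (τ.trans Fin.revPerm))).trans (finSuccEquiv' p).symm

@[simp] theorem consRev_zero {n : ℕ} (p : Fin (n + 1)) (τ : Equiv.Perm (Fin n)) :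
    consRev p τ 0 = p := by
  simp [consRev]

@[simp] theorem consRev_succ {n : ℕ} (p : Fin (n + 1)) (τ : Equiv.Perm (Fin n)) (i : Fin n) :
    consRev p τ i.succ = p.succAbove (τ i).rev := by
  simp [consRev]

theorem consRev_bijective (n : ℕ) :
    Function.Bijective fun x : Fin (n + 1) × Equiv.Perm (Fin n) => consRev x.1 x.2 := by
  rw [Fintype.bijective_iff_injective_and_card]
  constructor
  · rintro ⟨p, τ⟩ ⟨p', τ'⟩ h
    have h0 := DFunLike.congr_fun h 0
    simp only [consRev_zero] at h0
    subst h0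
    refine Prod.ext rfl (Equiv.ext fun i => ?_)
    have hi := DFunLike.congr_fun h i.succ
    simpa using hi
  · simp [Fintype.card_perm, Nat.factorial_succ]

/-- The position shift flips parity and complementing flips order, so the conditions on `τ` survive.
The initial descent says `n - 1 - τ 0 < p`; quantifying over `i` covers `n = 0`. -/
theorem isDownUp_consRev {n : ℕ} (p : Fin (n + 1)) (τ : Equiv.Perm (Fin n)) :
    IsDownUp (consRev p τ) ↔ IsDownUp τ ∧ ∀ i : Fin n, (i : ℕ) = 0 → n ≤ τ i + p := by
  have key (i : Fin n) : p.succAbove (τ i).rev < p ↔ n ≤ τ i + p := by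
    rw [Fin.succAbove_lt_iff_castSucc_lt, Fin.lt_def, Fin.val_castSucc, Fin.val_rev]
    omega
  constructor
  · intro H
    refine ⟨fun i j hij => ?_, fun i hi => ?_⟩
    · have := H i.succ j.succ (by simp [hij])
      simpa [Nat.even_add_one, Nat.odd_add_one, and_comm] using this
    · have := (H 0 i.succ (by simp [hi])).1 (by simp)
      simpa [key] using this
  · rintro ⟨H, H0⟩ i j hij
    obtain ⟨j, rfl⟩ : ∃ j', j = Fin.succ j' :=
      (Fin.exists_succ_eq.2 (by rintro rfl; simp at hij)).imp fun _ h => h.symm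
    cases i using Fin.cases with
    | zero => simpa [key] using H0 j (by simpa using hij)
    | succ i =>
      have := H i j (by simpa using hij)
      simpa [Nat.even_add_one, Nat.odd_add_one, and_comm] using this

theorem altInv_eq_sum {n : ℕ} (σ : Equiv.Perm (Fin n)) :
    altInv σ = ∑ i, ∑ j, if IsAltInversion σ i j then 1 else 0 := by
  rw [altInv, Finset.card_filter, ← Finset.univ_product_univ, Finset.sum_product]

/-- The first entry is inverted with the `p` smaller values; for other pairs the parity and order
flips cancel. -/
theorem altInv_consRev {n : ℕ} (p : Fin (n + 1)) (τ : Equiv.Perm (Fin n)) :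
    altInv (consRev p τ) = p + altInv τ := by
  rw [altInv_eq_sum, altInv_eq_sum, Fin.sum_univ_succ]
  congr 1
  · rw [Fin.sum_univ_succ]
    simp only [IsAltInversion, consRev_zero, consRev_succ, Fin.succAbove_lt_iff_castSucc_lt]
    have e : ∑ i : Fin n, (if (τ i).rev.castSucc < p then 1 else 0) =
        ∑ i : Fin n, (if i.castSucc < p then 1 else 0) :=
      Equiv.sum_comp (τ.trans Fin.revPerm) fun i : Fin n => if i.castSucc < p then 1 else 0
    simp only [Fin.succ_pos, Fin.val_zero, Even.zero, true_and, lt_irrefl, false_and, if_false,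
      zero_add, Nat.not_odd_zero, or_false]
    rw [e, ← Finset.card_filter]
    have := Fin.card_Iio p
    rw [← this, ← Finset.card_map Fin.castSuccEmb]
    congr 1
    ext j
    simp only [mem_map, mem_filter, mem_univ, true_and, Fin.coe_castSuccEmb, mem_Iio]
    constructor
    · rintro ⟨a, ha, rfl⟩; exact ha
    · intro hj
      exact ⟨j.castLT (by have := p.2; have := Fin.lt_def.1 hj; omega), by simpa using hj, by simp⟩
  · refine Finset.sum_congr rfl fun i _ => ?_
    rw [Fin.sum_univ_succ]
    simp [IsAltInversion, Nat.even_add_one, Nat.odd_add_one, or_comm]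

/-- Generating function for alternating inversions of the down-up permutations whose first value
is at least `n - d`. -/
noncomputable def downUpSum (n d : ℕ) : ℤ[X] :=
  ∑ σ : Equiv.Perm (Fin n) with IsDownUp σ ∧ ∀ i : Fin n, (i : ℕ) = 0 → n ≤ σ i + d, X ^ altInv σ

theorem downUpSum_succ (n d : ℕ) :
    downUpSum (n + 1) d =
      ∑ p : Fin (n + 1), if n + 1 ≤ p + d then X ^ (p : ℕ) * downUpSum n p else 0 := by
  have e (σ : Equiv.Perm (Fin (n + 1))) :
      (∀ i : Fin (n + 1), (i : ℕ) = 0 → n + 1 ≤ σ i + d) ↔ n + 1 ≤ σ 0 + d :=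
    ⟨fun H => H 0 rfl, fun H i hi => by obtain rfl : i = 0 := Fin.ext hi; exact H⟩
  simp only [downUpSum, e]
  rw [Finset.sum_filter, ← (consRev_bijective n).sum_comp, Fintype.sum_prod_type]
  refine Finset.sum_congr rfl fun p _ => ?_
  simp only [isDownUp_consRev, altInv_consRev, consRev_zero]
  split_ifs with h
  · simp [h, Finset.mul_sum, Finset.sum_filter, pow_add]
  · simp [h]

theorem downUpSum_eq_seidel {n d : ℕ} (hd : d ≤ n) : downUpSum n d = seidel n d := by
  induction n generalizing d with
  | zero =>
    rw [downUpSum, Finset.filter_true_of_mem (fun σ _ => ⟨fun i => i.elim0, fun i => i.elim0⟩)]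
    simp [seidel, altInv]
  | succ n ih =>
    induction d with
    | zero =>
      rw [downUpSum_succ, seidel]
      exact Finset.sum_eq_zero fun p _ => if_neg (by omega)
    | succ d ihd =>
      rw [seidel, ← ihd (by omega), ← ih (by omega), downUpSum_succ, downUpSum_succ]
      -- Raising `d` by one admits exactly one new first value, `n - d`.
      have e : X ^ (n - d) * downUpSum n (n - d) =
          ∑ p : Fin (n + 1), if p = (⟨n - d, by omega⟩ : Fin (n + 1)) then
            X ^ (p : ℕ) * downUpSum n p else 0 := by
        simp
      rw [e, ← Finset.sum_add_distrib]
      refine Finset.sum_congr rfl fun p _ => ?_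
      have := p.2
      simp only [Fin.ext_iff]
      split_ifs <;> first | omega | simp

theorem eulerHat_eq (n : ℕ) :
    eulerHat n = LaurentPolynomial.T (-((n ^ 2 / 4 : ℕ) : ℤ)) * toLaurent (seidel n n) := by
  rw [← downUpSum_eq_seidel le_rfl, eulerHat, downUpSum, map_sum]
  congr 1
  refine Finset.sum_congr ?_ fun σ _ => by rw [toLaurent_X_pow]
  ext σ
  simp

theorem eulerHat_eq_toLaurent {n : ℕ} {P : ℤ[X]} (h : seidel n n = X ^ (n ^ 2 / 4) * P) :
    toLaurent P = eulerHat n := by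
  rw [eulerHat_eq, h, map_mul, toLaurent_X_pow, ← mul_assoc, ← LaurentPolynomial.T_add]
  simp

end AltInv

theorem theorem9p4 (m : ℕ) :
    Polynomial.toLaurent (∑ p : { p : DyckWord // p.semilength = m }, AltInv.evenWeight p.1) =
        AltInv.eulerHat (2 * m) ∧
      Polynomial.toLaurent (∑ p : { p : DyckWord // p.semilength = m }, AltInv.oddWeight p.1) =
        AltInv.eulerHat (2 * m + 1) := by
  constructor
  · apply AltInv.eulerHat_eq_toLaurent
    rw [AltInv.seidel_even, AltInv.sum_evenWeight, show (2 * m) ^ 2 / 4 = m ^ 2 by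
      rw [mul_pow]; omega]
    rfl
  · apply AltInv.eulerHat_eq_toLaurent
    have h := AltInv.seidel_odd m
    rw [AltInv.tanSum_succ_succ_eq_pathSum, ← AltInv.sum_oddWeight] at h
    -- The exponents agree: `(m + 1)² + m = (2m + 1) + (m² + m)`.
    apply mul_left_cancel₀ (pow_ne_zero (2 * m + 1) (Polynomial.X_ne_zero (R := ℤ)))
    rw [h, ← mul_assoc, ← mul_assoc, ← pow_add, ← pow_add]
    congr 2
    have : (2 * m + 1) ^ 2 = 4 * (m ^ 2 + m) + 1 := by ring
    rw [this, show (4 * (m ^ 2 + m) + 1) / 4 = m ^ 2 + m by omega]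
    ring
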